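/- A queue machine is a tuple $M=(Q,\Sigma,\Gamma,\$,s,\delta)$ with $Q$ a finite set of states, $\Gamma$ a finite queue alphabet, $\Sigma\subset\Gamma$ an input alphabet, $\$\in\Gamma\setminus\Sigma$ the initial queue symbol, $s\in Q$ the start state and $\delta:Q\times\Gamma\to Q\times\Gamma^*$ the transition function. A configuration is a pair $(q,\gamma)\in Q\times\Gamma^*$; one has $(p,A\alpha)\to_M(q,\alpha\gamma)$ when $\delta(p,A)=(q,\gamma)$. The machine $M$ terminates on (accepts) $x\in\Sigma^*$ if $(s,x\$)\to_M^*(q,\epsilon)$ for some $q\in Q$, where $\epsilon$ is the empty word. $M$ is single consuming if $\delta(q,a)=(q',\epsilon)$ implies that there are no $b,q''$ with $\delta(q',b)=(q'',\epsilon)$. **Theorem.** (1) It is undecidable, given a single consuming queue machine $M$ and an input $x\in\Sigma^*$, whether $M$ terminates on $x$. That is, no partial computable function, given (a finite description of) any single consuming queue machine $M$ and any input $x$ of $M$, always halts and correctly answers whether $M$ terminates on $x$. (2) For a queue machine $M=(Q,\Sigma,\Gamma,\$,s,\delta)$ let $Q'=\{q' : q\in Q\}$ be a disjoint copy of $Q$,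 let $\#\notin\Gamma$, and let $\lceil M\rceil=(Q\cup Q',\Sigma,\Gamma\cup\{\#\},\$,s,\delta')$, where for $q\in Q$ and $a\in\Gamma$: - if $\delta(q,a)=(p,\epsilon)$, then $\delta'(q,a)=(p',\epsilon)$ and $\delta'(q',a)=(p,\#)$; - if $\delta(q,a)=(p,\gamma)$ with $\gamma\ne\epsilon$, then $\delta'(q,a)=\delta'(q',a)=(p,\gamma)$; - $\delta'(q,\#)=(q',\epsilon)$ and $\delta'(q',\#)=(q,\#)$. Then $\lceil M\rceil$ is single consuming, and for every $x\in\Sigma^*$, $M$ terminates on $x$ if and only if $\lceil M\rceil$ terminates on $x$. -/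

import Mathlib

/-- A queue machine `(Q, Σ, Γ, $, s, δ)` with state set `Q` and queue alphabet `Γ`; finiteness of
`Q` and `Γ` is required where machines are used. -/
structure QueueMachine (Q Γ : Type*) where
  /-- the input alphabet `Σ ⊆ Γ` -/
  inputAlphabet : Finset Γ
  /-- the initial queue symbol `$` -/
  initialSymbol : Γ
  initialSymbol_notMem : initialSymbol ∉ inputAlphabet
  /-- the start state `s` -/
  start : Q
  /-- the transition function `δ : Q × Γ → Q × Γ*` -/
  δ : Q → Γ → Q × List Γ

namespace QueueMachine

variable {Q Γ : Type*}

/-- `x` is an input string, that is, a word over the input alphabet. -/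
def IsInput (M : QueueMachine Q Γ) (x : List Γ) : Prop :=
  ∀ a ∈ x, a ∈ M.inputAlphabet

/-- The starting configuration `(s, x$)`. -/
def startConfig (M : QueueMachine Q Γ) (x : List Γ) : Q × List Γ :=
  (M.start, x ++ [M.initialSymbol])

/-- The transition relation: `(p, Aα) → (q, αγ)` when `δ(p, A) = (q, γ)`. -/
inductive Step (M : QueueMachine Q Γ) : Q × List Γ → Q × List Γ → Prop
  | mk (p : Q) (A : Γ) (α : List Γ) (q : Q) (γ : List Γ) (h : M.δ p A = (q, γ)) :
      Step M (p, A :: α) (q, α ++ γ)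

/-- `M` terminates on (equivalently, accepts) `x`: it blocks by emptying the queue. -/
def Terminates (M : QueueMachine Q Γ) (x : List Γ) : Prop :=
  ∃ q : Q, Relation.ReflTransGen M.Step (M.startConfig x) (q, [])

/-- Single consuming machines: a step that enqueues nothing leads to a state from which no step
enqueues nothing. -/
def SingleConsuming (M : QueueMachine Q Γ) : Prop :=
  ∀ (q : Q) (a : Γ) (q' : Q), M.δ q a = (q', []) →
    ¬ ∃ (b : Γ) (q'' : Q), M.δ q' b = (q'', [])

/-- The transition function of the encoding. The states are `inl q` (for `q`) and `inr q`
(for the primed copy `q'`), the symbols are `some a` (for `a ∈ Γ`) and `none` (for the new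
symbol `#`). -/
def encodeδ (M : QueueMachine Q Γ) : Q ⊕ Q → Option Γ → (Q ⊕ Q) × List (Option Γ)
  | Sum.inl q, some a =>
    match M.δ q a with
    | (p, []) => (Sum.inr p, [])
    | (p, c :: γ) => (Sum.inl p, (c :: γ).map some)
  | Sum.inl q, none => (Sum.inr q, [])
  | Sum.inr q, some a =>
    match M.δ q a with
    | (p, []) => (Sum.inl p, [none])
    | (p, c :: γ) => (Sum.inl p, (c :: γ).map some)
  | Sum.inr q, none => (Sum.inl q, [none])

/-- The encoding `⌈M⌉` of a queue machine, with primed states and the padding symbol `#`. -/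
def encode (M : QueueMachine Q Γ) : QueueMachine (Q ⊕ Q) (Option Γ) where
  inputAlphabet := M.inputAlphabet.map Function.Embedding.some
  initialSymbol := some M.initialSymbol
  initialSymbol_notMem := by
    simpa using M.initialSymbol_notMem
  start := Sum.inl M.start
  δ := M.encodeδ

end QueueMachine

/-- Finite descriptions of queue machines as data handed to an algorithm: the numbers of states and
of queue symbols, the list of input symbols, the initial symbol, the start state and the table of
the transition function. -/
abbrev QueueMachineCode : Type :=
  ℕ × ℕ × List ℕ × ℕ × ℕ × List (List (ℕ × List ℕ))

/-- The description of a queue machine with states `0, …, n - 1` and symbols `0, …, m - 1`. -/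
def QueueMachine.code {n m : ℕ} (M : QueueMachine (Fin n) (Fin m)) : QueueMachineCode :=
  (n, m, ((List.finRange m).filter (fun a => a ∈ M.inputAlphabet)).map Fin.val,
    M.initialSymbol.val, M.start.val,
    (List.finRange n).map fun q => (List.finRange m).map fun a =>
      ((M.δ q a).1.val, (M.δ q a).2.map Fin.val))

/-- The partial function `f` decides termination of single consuming queue machines: given (the
description of) any such machine and any input for it, `f` is defined and returns the correct
answer. Nothing is required of `f` on other arguments. -/
def DecidesSingleConsumingTermination (f : QueueMachineCode × List ℕ →. Bool) : Prop :=
  ∀ (n m : ℕ) (M : QueueMachine (Fin n) (Fin m)), M.SingleConsuming →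
    ∀ x : List (Fin m), M.IsInput x →
      ∃ b ∈ f (M.code, x.map Fin.val), (b = true ↔ M.Terminates x)

/-! For the encoding: a primed state always enqueues something, so two erasing steps cannot be
consecutive. The symbol `#` only toggles the prime and is dropped or recycled, so up to primes and
padding the encoding runs as `M` does (`encode_respects`). Leftover padding does not prevent
termination, since a queue of `#`s alone drains (`encode_reaches_nil`). `tr_eval_dom` turns this
simulation into equivalence of termination.

For undecidability: the halting problem reduces to inputs of one fixed machine. The function sending
a program to its output on `0` is computed by a machine with four stacks. These lie in the queue one
after another, each behind a marker, and one rotation of the queue executes one instruction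
(`reaches₁_simConfig`). Finitely many control states suffice (`exists_finite_invariant`), and
`encode` makes the machine single consuming. The input word depends primitive recursively on the
program, so a decider would solve the halting problem. -/

open StateTransition Relation Turing

/-! ### Queue machines as deterministic systems, restriction and renaming. -/

namespace QueueMachine

variable {Q Γ Q' Γ' : Type*}

/-- The transition relation as a partial function on configurations. -/
def next (M : QueueMachine Q Γ) : Q × List Γ → Option (Q × List Γ)
  | (_, []) => none
  | (p, A :: α) => some ((M.δ p A).1, α ++ (M.δ p A).2)

@[simp] theorem next_nil (M : QueueMachine Q Γ) (p : Q) : M.next (p, []) = none := rfl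

@[simp] theorem next_cons (M : QueueMachine Q Γ) (p : Q) (A : Γ) (α : List Γ) :
    M.next (p, A :: α) = some ((M.δ p A).1, α ++ (M.δ p A).2) := rfl

theorem step_iff_mem_next (M : QueueMachine Q Γ) (c d : Q × List Γ) :
    M.Step c d ↔ d ∈ M.next c := by
  constructor
  · rintro ⟨p, A, α, q, γ, h⟩
    simp [h]
  · obtain ⟨p, _ | ⟨A, α⟩⟩ := c
    · simp
    · rintro h
      rw [next_cons, Option.mem_some_iff] at h
      subst h
      exact .mk _ _ _ _ _ rfl

/-- A configuration has no successor exactly when its queue is empty, so blocking and emptying the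
queue coincide. -/
theorem terminates_iff_eval_dom (M : QueueMachine Q Γ) (x : List Γ) :
    M.Terminates x ↔ (eval M.next (M.startConfig x)).Dom := by
  have hstep : M.Step = fun a b => b ∈ M.next a := by
    ext c d
    exact M.step_iff_mem_next c d
  rw [Part.dom_iff_mem, Terminates, hstep]
  constructor
  · rintro ⟨q, h⟩
    exact ⟨_, mem_eval.2 ⟨h, rfl⟩⟩
  · rintro ⟨⟨q, _ | ⟨A, α⟩⟩, h⟩
    · exact ⟨q, (mem_eval.1 h).1⟩
    · simpa using (mem_eval.1 h).2

/-- A map of states and symbols that commutes with the transition functions and preserves the start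
configuration preserves and reflects termination. -/
theorem terminates_map_iff (M : QueueMachine Q Γ) (N : QueueMachine Q' Γ') (φ : Q → Q') (ψ : Γ → Γ')
    (hstart : φ M.start = N.start) (hinit : ψ M.initialSymbol = N.initialSymbol)
    (hδ : ∀ q a, N.δ (φ q) (ψ a) = (φ (M.δ q a).1, (M.δ q a).2.map ψ)) (x : List Γ) :
    N.Terminates (x.map ψ) ↔ M.Terminates x := by
  rw [terminates_iff_eval_dom, terminates_iff_eval_dom]
  refine tr_eval_dom (tr := fun c d => (φ c.1, c.2.map ψ) = d) ?_ (by simp [startConfig, *])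
  rintro ⟨p, _ | ⟨A, α⟩⟩ _ rfl
  · simp
  · exact ⟨_, rfl, TransGen.single (by simp [hδ])⟩

/-- The restriction of a machine to a set of states containing the start state and closed under
transitions. -/
def restrict (M : QueueMachine Q Γ) (P : Q → Prop) (hstart : P M.start)
    (hδ : ∀ q a, P q → P (M.δ q a).1) : QueueMachine {q // P q} Γ where
  inputAlphabet := M.inputAlphabet
  initialSymbol := M.initialSymbol
  initialSymbol_notMem := M.initialSymbol_notMem
  start := ⟨M.start, hstart⟩
  δ q a := (⟨(M.δ q a).1, hδ q a q.2⟩, (M.δ q a).2)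

theorem restrict_terminates_iff (M : QueueMachine Q Γ) (P : Q → Prop) (hstart : P M.start)
    (hδ : ∀ q a, P q → P (M.δ q a).1) (x : List Γ) :
    (M.restrict P hstart hδ).Terminates x ↔ M.Terminates x := by
  simpa using (terminates_map_iff (M.restrict P hstart hδ) M Subtype.val id rfl rfl
    (fun q a => by simp [restrict]) x).symm

/-- Renaming of states and symbols along bijections. -/
def reindex (M : QueueMachine Q Γ) (e : Q ≃ Q') (f : Γ ≃ Γ') : QueueMachine Q' Γ' where
  inputAlphabet := M.inputAlphabet.map f.toEmbedding
  initialSymbol := f M.initialSymbol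
  initialSymbol_notMem := by simpa using M.initialSymbol_notMem
  start := e M.start
  δ q a := (e (M.δ (e.symm q) (f.symm a)).1, (M.δ (e.symm q) (f.symm a)).2.map f)

theorem reindex_terminates_iff (M : QueueMachine Q Γ) (e : Q ≃ Q') (f : Γ ≃ Γ') (x : List Γ) :
    (M.reindex e f).Terminates (x.map f) ↔ M.Terminates x :=
  terminates_map_iff M (M.reindex e f) e f rfl rfl (fun q a => by simp [reindex]) x

theorem SingleConsuming.reindex {M : QueueMachine Q Γ} (h : M.SingleConsuming) (e : Q ≃ Q')
    (f : Γ ≃ Γ') : (M.reindex e f).SingleConsuming := by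
  rintro q a q' hq ⟨b, q'', hq'⟩
  simp only [QueueMachine.reindex, Prod.mk.injEq, List.map_eq_nil_iff] at hq hq'
  refine h (e.symm q) (f.symm a) (e.symm q') (Prod.ext ?_ hq.2)
    ⟨f.symm b, e.symm q'', Prod.ext ?_ hq'.2⟩
  · simp [← hq.1]
  · simp [← hq'.1]

/-! ### The encoding by padding. -/

theorem encode_singleConsuming (M : QueueMachine Q Γ) : M.encode.SingleConsuming := by
  have hinr : ∀ q b q'', M.encode.δ (Sum.inr q) b ≠ (q'', []) := by
    intro q b q'' h
    rcases b with _ | b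
    · simp [encode, encodeδ] at h
    · simp only [encode, encodeδ] at h
      split at h <;> simp at h
  rintro (q | q) a q' h
  · suffices ∃ p, q' = Sum.inr p by
      obtain ⟨p, rfl⟩ := this
      rintro ⟨b, q'', h'⟩
      exact hinr _ _ _ h'
    rcases a with _ | a
    · simp only [encode, encodeδ, Prod.mk.injEq] at h
      exact ⟨_, h.1.symm⟩
    · simp only [encode, encodeδ] at h
      split at h <;> simp at h
      exact ⟨_, h.symm⟩
  · exact absurd h (hinr _ _ _)

/-- The configurations of the encoding that represent a configuration of `M`: the padding symbols
are ignored, except that the empty queue is represented by itself only. -/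
def EncodeRel (c : Q × List Γ) (d : (Q ⊕ Q) × List (Option Γ)) : Prop :=
  (d.1 = Sum.inl c.1 ∨ d.1 = Sum.inr c.1) ∧ d.2.reduceOption = c.2 ∧ (c.2 = [] → d.2 = [])

/-- The unprimed state erases a `#` and the primed state recycles one, so at most two steps shorten
a queue of padding by one. -/
theorem encode_reaches_nil (M : QueueMachine Q Γ) (p : Q) (k : ℕ) (s : Q ⊕ Q)
    (hs : s = Sum.inl p ∨ s = Sum.inr p) :
    ∃ t, (t = Sum.inl p ∨ t = Sum.inr p) ∧
      Reaches M.encode.next (s, List.replicate k none) (t, []) := by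
  have hinr : ∀ k, Reaches M.encode.next (Sum.inr p, List.replicate (k + 1) none)
      (Sum.inl p, List.replicate (k + 1) none) := fun k => .single (by
    rw [List.replicate_succ, next_cons, ← List.replicate_succ, List.replicate_succ']
    simp [encode, encodeδ])
  have hinl : ∀ k, Reaches M.encode.next (Sum.inl p, List.replicate (k + 1) none)
      (Sum.inr p, List.replicate k none) := fun k => .single (by
    simp [List.replicate_succ, encode, encodeδ])
  induction k generalizing s with
  | zero => exact ⟨s, hs, .refl⟩
  | succ k ih =>
    obtain ⟨t, ht, h⟩ := ih (Sum.inr p) (.inr rfl)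
    refine ⟨t, ht, ?_⟩
    rcases hs with rfl | rfl
    · exact (hinl k).trans h
    · exact (hinr k).trans ((hinl k).trans h)

/-- Recycled padding lands behind `a`, so each step reduces the number of `#`s in front of it,
whichever copy of the state is current. -/
theorem encode_reaches_cons (M : QueueMachine Q Γ) (k : ℕ) (s : Q ⊕ Q) (p : Q) (a : Γ)
    (r : List (Option Γ)) (hs : s = Sum.inl p ∨ s = Sum.inr p) :
    ∃ t r', (t = Sum.inl p ∨ t = Sum.inr p) ∧ r'.reduceOption = r.reduceOption ∧
      Reaches M.encode.next (s, List.replicate k none ++ some a :: r) (t, some a :: r') := by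
  induction k generalizing s r with
  | zero => exact ⟨s, r, hs, rfl, .refl⟩
  | succ k ih =>
    rcases hs with rfl | rfl
    · obtain ⟨t, r', ht, hr, h⟩ := ih (Sum.inr p) r (.inr rfl)
      exact ⟨t, r', ht, hr, .head (by simp [List.replicate_succ, encode, encodeδ]) h⟩
    · obtain ⟨t, r', ht, hr, h⟩ := ih (Sum.inl p) (r ++ [none]) (.inl rfl)
      refine ⟨t, r', ht, by simpa [List.reduceOption_append] using hr, .head ?_ h⟩
      simp [List.replicate_succ, encode, encodeδ]

theorem reduceOption_map_some (l : List Γ) : (l.map some).reduceOption = l := by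
  induction l <;> simp_all

theorem exists_replicate_of_reduceOption_cons {w : List (Option Γ)} {a : Γ} {α : List Γ}
    (h : w.reduceOption = a :: α) :
    ∃ k r, w = List.replicate k none ++ some a :: r ∧ r.reduceOption = α := by
  induction w with
  | nil => simp at h
  | cons b w ih =>
    rcases b with _ | b
    · obtain ⟨k, r, rfl, hr⟩ := ih (by simpa using h)
      exact ⟨k + 1, r, rfl, hr⟩
    · simp only [List.reduceOption_cons_of_some, List.cons.injEq] at h
      exact ⟨0, w, by simp [h.1], h.2⟩

theorem eq_replicate_of_reduceOption_nil {w : List (Option Γ)} (h : w.reduceOption = []) :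
    w = List.replicate w.length none := by
  induction w with
  | nil => rfl
  | cons b w ih =>
    rcases b with _ | b
    · simpa [List.replicate_succ] using ih (by simpa using h)
    · simp at h

theorem encode_respects (M : QueueMachine Q Γ) :
    Respects M.next M.encode.next (EncodeRel (Q := Q) (Γ := Γ)) := by
  rintro ⟨p, _ | ⟨a, α⟩⟩ ⟨s, w⟩ ⟨hs, hw, hnil⟩
  · obtain rfl : w = [] := hnil rfl
    simp
  · obtain ⟨k, r, rfl, hr⟩ := exists_replicate_of_reduceOption_cons hw
    obtain ⟨t, r', ht, hr', h⟩ := M.encode_reaches_cons k s p a r hs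
    rw [hr] at hr'
    obtain ⟨s', w', hs', hw', hstep⟩ : ∃ s' w',
        (s' = Sum.inl (M.δ p a).1 ∨ s' = Sum.inr (M.δ p a).1) ∧
        w'.reduceOption = α ++ (M.δ p a).2 ∧ (s', w') ∈ M.encode.next (t, some a :: r') := by
      rcases hδ : M.δ p a with ⟨q, _ | ⟨c, γ⟩⟩
      · rcases ht with rfl | rfl
        · exact ⟨Sum.inr q, r', .inr rfl, by simpa using hr', by simp [encode, encodeδ, hδ]⟩
        · exact ⟨Sum.inl q, r' ++ [none], .inl rfl, by simp [List.reduceOption_append, hr'],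
            by simp [encode, encodeδ, hδ]⟩
      · refine ⟨Sum.inl q, r' ++ (c :: γ).map some, .inl rfl, ?_, ?_⟩
        · rw [List.reduceOption_append, reduceOption_map_some, hr']
        · rcases ht with rfl | rfl <;> simp [encode, encodeδ, hδ]
    have hreach : Reaches₁ M.encode.next (s, List.replicate k none ++ some a :: r) (s', w') :=
      TransGen.tail' h hstep
    -- When `M` has just emptied its queue, padding may remain in the encoding; it must be drained
    -- to reach a blocked configuration.
    by_cases hβ : α ++ (M.δ p a).2 = []
    · rw [hβ] at hw'
      obtain ⟨u, hu, hu'⟩ := M.encode_reaches_nil (M.δ p a).1 w'.length s' hs'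
      rw [← eq_replicate_of_reduceOption_nil hw'] at hu'
      exact ⟨(u, []), ⟨hu, by simp [hβ], fun _ => rfl⟩, hreach.trans_left hu'⟩
    · exact ⟨(s', w'), ⟨hs', hw', fun h => absurd h hβ⟩, hreach⟩

theorem encode_terminates_iff (M : QueueMachine Q Γ) (x : List Γ) :
    M.encode.Terminates (x.map some) ↔ M.Terminates x := by
  rw [terminates_iff_eval_dom, terminates_iff_eval_dom]
  refine tr_eval_dom M.encode_respects ⟨.inl rfl, ?_, by simp [startConfig]⟩
  simp [startConfig, encode, List.reduceOption_append, reduceOption_map_some]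

end QueueMachine

/-! ### Simulation of stack machines by queue machines. -/

namespace StackToQueue

variable {K A Λ σ : Type*}

/-- The phases of a pass over the queue: searching for the stack to operate on, having just read
its marker, and copying the rest. -/
inductive Phase
  | seek
  | found
  | done
  deriving DecidableEq

instance : Fintype Phase where
  elems := {.seek, .found, .done}
  complete := by rintro ⟨⟩ <;> simp

/-- Statements of a machine with stacks over a common alphabet. -/
abbrev Stmt (K A Λ σ : Type*) := TM2.Stmt (fun _ : K => A) Λ σ

/-- Control states of the simulating queue machine. -/
abbrev State (K A Λ σ : Type*) := Stmt K A Λ σ × σ × Phase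

/-- The contents of the stacks, top first, each preceded by its marker. -/
def stackWord (S : K → List A) (ks : List K) : List (K ⊕ A) :=
  ks.flatMap fun k => Sum.inl k :: (S k).map Sum.inr

theorem stackWord_append (S : K → List A) (ks ls : List K) :
    stackWord S (ks ++ ls) = stackWord S ks ++ stackWord S ls := by
  simp [stackWord]

theorem stackWord_cons (S : K → List A) (k : K) (ks : List K) :
    stackWord S (k :: ks) = Sum.inl k :: ((S k).map Sum.inr ++ stackWord S ks) := by
  simp [stackWord]

theorem inl_mem_stackWord {S : K → List A} {ks : List K} {k : K} :
    Sum.inl k ∈ stackWord S ks ↔ k ∈ ks := by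
  simp [stackWord]

variable [DecidableEq K]

theorem stackWord_update {S : K → List A} {ks : List K} {k : K} (h : k ∉ ks) (l : List A) :
    stackWord (Function.update S k l) ks = stackWord S ks := by
  induction ks with
  | nil => rfl
  | cons j ks ih =>
    simp only [List.mem_cons, not_or] at h
    rw [stackWord_cons, stackWord_cons, ih h.2, Function.update_of_ne (Ne.symm h.1)]

/-- The action on a marker or a stack symbol during the pass that executes a statement. -/
def passStep : Stmt K A Λ σ → σ → Phase → K ⊕ A → σ × Phase × List (K ⊕ A)
  | .push k f _, v, .seek, .inl j => (v, .seek, .inl j :: if j = k then [.inr (f v)] else [])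
  | .peek k _ _, v, .seek, .inl j => (v, if j = k then .found else .seek, [.inl j])
  | .peek _ f _, v, .found, .inl j => (f v none, .done, [.inl j])
  | .peek _ f _, v, .found, .inr a => (f v (some a), .done, [.inr a])
  | .pop k _ _, v, .seek, .inl j => (v, if j = k then .found else .seek, [.inl j])
  | .pop _ f _, v, .found, .inl j => (f v none, .done, [.inl j])
  | .pop _ f _, v, .found, .inr a => (f v (some a), .done, [])
  | .halt, v, ph, _ => (v, ph, [])
  | _, v, ph, c => (v, ph, [c])

/-- The statement to execute next, and the new variable, at the end of a pass. -/
def finish (M : Λ → Stmt K A Λ σ) : Stmt K A Λ σ → σ → Phase → Stmt K A Λ σ × σ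
  | .push _ _ q, v, _ => (q, v)
  | .peek _ f q, v, .found => (q, f v none)
  | .peek _ _ q, v, _ => (q, v)
  | .pop _ f q, v, .found => (q, f v none)
  | .pop _ _ q, v, _ => (q, v)
  | .load f q, v, _ => (q, f v)
  | .branch f q₁ q₂, v, _ => (if f v then q₁ else q₂, v)
  | .goto l, v, _ => (M (l v), v)
  | .halt, v, _ => (.halt, v)

open scoped Classical in
/-- The queue machine that executes the statements of a stack machine, one pass over the queue for
each. The symbol `none` is both the initial symbol and the end marker. -/
noncomputable def machine [Fintype K] [Fintype A] (M : Λ → Stmt K A Λ σ) (q₀ : Stmt K A Λ σ)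
    (v₀ : σ) : QueueMachine (State K A Λ σ) (Option (K ⊕ A)) where
  inputAlphabet := Finset.univ.map Function.Embedding.some
  initialSymbol := none
  initialSymbol_notMem := by simp
  start := (q₀, v₀, .seek)
  δ
    | (q, v, ph), some c =>
      ((q, (passStep q v ph c).1, (passStep q v ph c).2.1), (passStep q v ph c).2.2.map some)
    | (q, v, ph), none =>
      (((finish M q v ph).1, (finish M q v ph).2, .seek), if q = .halt then [] else [none])

variable [Fintype K] [Fintype A] {M : Λ → Stmt K A Λ σ} {q₀ : Stmt K A Λ σ} {v₀ : σ}

variable (M q₀ v₀) in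
/-- While executing `q`, the machine rewrites the word `w` to `w'`. -/
def Pass (q : Stmt K A Λ σ) (v : σ) (ph : Phase) (w : List (K ⊕ A)) (v' : σ) (ph' : Phase)
    (w' : List (K ⊕ A)) : Prop :=
  ∀ r, Reaches (machine M q₀ v₀).next ((q, v, ph), w.map some ++ r)
    ((q, v', ph'), r ++ w'.map some)

theorem Pass.nil (q : Stmt K A Λ σ) (v : σ) (ph : Phase) : Pass M q₀ v₀ q v ph [] v ph [] :=
  fun r => by
  rw [List.map_nil, List.nil_append, List.append_nil]
  exact .refl

theorem Pass.append {q : Stmt K A Λ σ} {v₁ v₂ v₃ : σ} {p₁ p₂ p₃ : Phase} {w₁ w₂ u₁ u₂ : List (K ⊕ A)}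
    (h₁ : Pass M q₀ v₀ q v₁ p₁ w₁ v₂ p₂ u₁) (h₂ : Pass M q₀ v₀ q v₂ p₂ w₂ v₃ p₃ u₂) :
    Pass M q₀ v₀ q v₁ p₁ (w₁ ++ w₂) v₃ p₃ (u₁ ++ u₂) := fun r => by
  have h₁' := h₁ (w₂.map some ++ r)
  have h₂' := h₂ (r ++ u₁.map some)
  simp only [List.append_assoc, List.map_append] at h₁' h₂' ⊢
  exact h₁'.trans h₂'

theorem Pass.cons {q : Stmt K A Λ σ} {v₁ v₂ v₃ : σ} {p₁ p₂ p₃ : Phase} {c : K ⊕ A}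
    {w u₁ u₂ : List (K ⊕ A)} (h₁ : passStep q v₁ p₁ c = (v₂, p₂, u₁))
    (h₂ : Pass M q₀ v₀ q v₂ p₂ w v₃ p₃ u₂) :
    Pass M q₀ v₀ q v₁ p₁ (c :: w) v₃ p₃ (u₁ ++ u₂) :=
  Pass.append (w₁ := [c]) (fun r => .single (by simp [machine, h₁])) h₂

theorem Pass.copy {q : Stmt K A Λ σ} {v : σ} {ph : Phase} {w : List (K ⊕ A)}
    (h : ∀ c ∈ w, passStep q v ph c = (v, ph, [c])) : Pass M q₀ v₀ q v ph w v ph w := by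
  induction w with
  | nil => exact .nil q v ph
  | cons c w ih => exact .cons (h c (by simp)) (ih fun c hc => h c (by simp [hc]))

/-- A pass over the whole queue executes the first instruction of a statement. -/
theorem reaches₁_of_pass {q : Stmt K A Λ σ} (hq : q ≠ .halt) {v v' : σ} {ph : Phase}
    {w w' : List (K ⊕ A)} (h : Pass M q₀ v₀ q v .seek w v' ph w') :
    Reaches₁ (machine M q₀ v₀).next ((q, v, .seek), w.map some ++ [none])
      (((finish M q v' ph).1, (finish M q v' ph).2, .seek), w'.map some ++ [none]) :=
  .tail' (h [none]) (by simp [machine, hq])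

/-- A halted stack machine must correspond to an empty queue, so here everything is erased, the end
marker included. -/
theorem reaches₁_halt (v : σ) (w : List (K ⊕ A)) :
    Reaches₁ (machine M q₀ v₀).next ((.halt, v, .seek), w.map some ++ [none])
      ((.halt, v, .seek), []) := by
  induction w with
  | nil => exact .single (by simp [machine, finish])
  | cons c w ih => exact .head (by simp [machine, passStep]) ih

/-- The configuration that represents a configuration of the stack machine. -/
def simConfig (M : Λ → Stmt K A Λ σ) (ks : List K) :
    TM2.Cfg (fun _ : K => A) Λ σ → State K A Λ σ × List (Option (K ⊕ A))
  | ⟨some l, v, S⟩ => ((M l, v, .seek), (stackWord S ks).map some ++ [none])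
  | ⟨none, v, _⟩ => ((.halt, v, .seek), [])

/-- Induction on the statement: one pass executes its first instruction, and the induction
hypothesis runs the rest. Away from the marker of the stack concerned and the symbol after it, a
pass copies. -/
theorem reaches₁_simConfig {ks : List K} (hks : ks.Nodup) (hmem : ∀ k, k ∈ ks)
    (q : Stmt K A Λ σ) (v : σ) (S : K → List A) :
    Reaches₁ (machine M q₀ v₀).next ((q, v, .seek), (stackWord S ks).map some ++ [none])
      (simConfig M ks (TM2.stepAux q v S)) := by
  -- The marker of each stack occurs exactly once, so the pass finds one well-defined place to act.
  have hsplit : ∀ k, ∃ l₁ l₂, ks = l₁ ++ k :: l₂ ∧ k ∉ l₁ ∧ k ∉ l₂ := fun k => by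
    obtain ⟨l₁, l₂, rfl⟩ := List.append_of_mem (hmem k)
    have := List.nodup_middle.1 hks
    simp only [List.nodup_cons, List.mem_append, not_or] at this
    exact ⟨l₁, l₂, rfl, this.1⟩
  induction q generalizing v S with
  | push k f q ih =>
    refine TransGen.trans (?_ : Reaches₁ _ _ _) (ih v (Function.update S k (f v :: S k)))
    refine reaches₁_of_pass (ph := .seek) (v' := v) (by simp) ?_
    obtain ⟨l₁, l₂, rfl, h₁, h₂⟩ := hsplit k
    have hcopy : ∀ c : K ⊕ A, c ≠ .inl k →
        passStep (.push k f q : Stmt K A Λ σ) v .seek c = (v, .seek, [c]) := by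
      rintro (j | a) hc
      · have : j ≠ k := by simpa using hc
        simp [passStep, this]
      · rfl
    rw [stackWord_append, stackWord_append, stackWord_cons, stackWord_cons, stackWord_update h₁, stackWord_update h₂]
    refine .append (.copy fun c hc => hcopy c ?_) ?_
    · rintro rfl
      exact h₁ (inl_mem_stackWord.1 hc)
    · simp only [Function.update_self, List.map_cons]
      refine .cons (u₁ := [.inl k, .inr (f v)]) (by simp [passStep]) (.copy fun c hc => hcopy c ?_)
      rintro rfl
      simp [inl_mem_stackWord, h₂] at hc
  | peek k f q ih =>
    refine TransGen.trans (?_ : Reaches₁ _ _ _) (ih (f v (S k).head?) S)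
    obtain ⟨l₁, l₂, rfl, h₁, h₂⟩ := hsplit k
    have hcopy : ∀ c : K ⊕ A, c ≠ .inl k →
        passStep (.peek k f q : Stmt K A Λ σ) v .seek c = (v, .seek, [c]) := by
      rintro (j | a) hc
      · have : j ≠ k := by simpa using hc
        simp [passStep, this]
      · rfl
    have hdone : ∀ v' w, Pass M q₀ v₀ (.peek k f q) v' .done w v' .done w :=
      fun v' w => .copy fun c _ => by cases c <;> rfl
    have hpre : Pass M q₀ v₀ (.peek k f q) v .seek (stackWord S l₁ ++ [.inl k]) v .found
        (stackWord S l₁ ++ [.inl k]) := by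
      refine .append (.copy fun c hc => hcopy c ?_)
        (.cons (v₂ := v) (p₂ := .found) (u₁ := [.inl k]) (by simp [passStep]) (.nil _ _ _))
      rintro rfl
      exact h₁ (inl_mem_stackWord.1 hc)
    suffices ∃ v' ph, Pass M q₀ v₀ (.peek k f q) v .found ((S k).map .inr ++ stackWord S l₂) v' ph
        ((S k).map .inr ++ stackWord S l₂) ∧
        finish M (.peek k f q) v' ph = (q, f v (S k).head?) by
      obtain ⟨v', ph, h, hf⟩ := this
      have := reaches₁_of_pass (by simp) (hpre.append h)
      simpa [stackWord_append, stackWord_cons, hf] using this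
    -- An empty stack shows as a following marker, or, for the last stack, as the end of the queue;
    -- in that case the phase is still `found` and `finish` supplies `none`.
    rcases S k with _ | ⟨a, s⟩
    · rcases l₂ with _ | ⟨j, l₂⟩
      · exact ⟨v, .found, .nil _ _ _, rfl⟩
      · rw [stackWord_cons]
        exact ⟨_, .done, .cons (u₁ := [.inl j]) rfl (hdone _ _), rfl⟩
    · exact ⟨_, .done, .cons (u₁ := [.inr a]) rfl (hdone _ _), rfl⟩
  | pop k f q ih =>
    refine TransGen.trans (?_ : Reaches₁ _ _ _) (ih (f v (S k).head?) (Function.update S k (S k).tail))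
    obtain ⟨l₁, l₂, rfl, h₁, h₂⟩ := hsplit k
    have hcopy : ∀ c : K ⊕ A, c ≠ .inl k →
        passStep (.pop k f q : Stmt K A Λ σ) v .seek c = (v, .seek, [c]) := by
      rintro (j | a) hc
      · have : j ≠ k := by simpa using hc
        simp [passStep, this]
      · rfl
    have hdone : ∀ v' w, Pass M q₀ v₀ (.pop k f q) v' .done w v' .done w :=
      fun v' w => .copy fun c _ => by cases c <;> rfl
    have hpre : Pass M q₀ v₀ (.pop k f q) v .seek (stackWord S l₁ ++ [.inl k]) v .found
        (stackWord S l₁ ++ [.inl k]) := by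
      refine .append (.copy fun c hc => hcopy c ?_)
        (.cons (v₂ := v) (p₂ := .found) (u₁ := [.inl k]) (by simp [passStep]) (.nil _ _ _))
      rintro rfl
      exact h₁ (inl_mem_stackWord.1 hc)
    suffices ∃ v' ph, Pass M q₀ v₀ (.pop k f q) v .found ((S k).map .inr ++ stackWord S l₂) v' ph
        ((S k).tail.map .inr ++ stackWord S l₂) ∧
        finish M (.pop k f q) v' ph = (q, f v (S k).head?) by
      obtain ⟨v', ph, h, hf⟩ := this
      have := reaches₁_of_pass (by simp) (hpre.append h)
      simpa [stackWord_append, stackWord_cons, hf, stackWord_update h₁, stackWord_update h₂] using this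
    rcases S k with _ | ⟨a, s⟩
    · rcases l₂ with _ | ⟨j, l₂⟩
      · exact ⟨v, .found, .nil _ _ _, rfl⟩
      · rw [stackWord_cons]
        exact ⟨_, .done, .cons (u₁ := [.inl j]) rfl (hdone _ _), rfl⟩
    · exact ⟨_, .done, .cons (u₁ := []) rfl (hdone _ _), rfl⟩
  | load f q ih =>
    exact .trans (reaches₁_of_pass (by simp) (.copy fun c _ => rfl)) (ih (f v) S)
  | branch f q₁ q₂ ih₁ ih₂ =>
    refine .trans (reaches₁_of_pass (by simp) (.copy fun c _ => rfl)) (?_ : Reaches₁ _ _ _)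
    rw [TM2.stepAux]
    cases hf : f v
    · simpa [finish, hf] using ih₂ v S
    · simpa [finish, hf] using ih₁ v S
  | goto l =>
    exact reaches₁_of_pass (by simp) (.copy fun c _ => rfl)
  | halt => exact reaches₁_halt v _

theorem machine_terminates_iff {ks : List K} (hks : ks.Nodup) (hmem : ∀ k, k ∈ ks)
    (l : Λ) (v : σ) (S : K → List A) :
    (machine M (M l) v).Terminates ((stackWord S ks).map some) ↔
      (eval (TM2.step M) ⟨some l, v, S⟩).Dom := by
  rw [QueueMachine.terminates_iff_eval_dom]
  refine tr_eval_dom (tr := fun c d => simConfig M ks c = d) ?_ rfl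
  rintro ⟨_ | l, v, S⟩ _ rfl
  · simp [simConfig]
  · exact ⟨_, rfl, reaches₁_simConfig hks hmem _ _ _⟩

/-- Only finitely many control states are needed when the labels are confined to a finite set. -/
theorem exists_finite_invariant [Finite σ] {S : Finset Λ}
    (hS : ∀ l ∈ S, TM2.SupportsStmt S (M l)) {l : Λ} (hl : l ∈ S) :
    ∃ P : State K A Λ σ → Prop, Finite {p // P p} ∧ (∀ v, P (M l, v, .seek)) ∧
      ∀ p a, P p → P ((machine M q₀ v₀).δ p a).1 := by
  -- The substatements of the supported labels are finite in number and closed under `finish`;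
  -- variables and phases range over finite types.
  classical
  let T : Finset (Stmt K A Λ σ) := insert .halt (S.biUnion fun l => TM2.stmts₁ (M l))
  have hlabel : ∀ l ∈ S, M l ∈ T := fun l hl =>
    Finset.mem_insert_of_mem (Finset.mem_biUnion.2 ⟨l, hl, TM2.stmts₁_self⟩)
  have hfinish : ∀ q ∈ T, ∀ v ph, (finish M q v ph).1 ∈ T := by
    intro q hq v ph
    rcases Finset.mem_insert.1 hq with rfl | hq
    · exact Finset.mem_insert_self _ _
    obtain ⟨l, hl, hq⟩ := Finset.mem_biUnion.1 hq
    have hsub : ∀ q' ∈ TM2.stmts₁ q, q' ∈ T := fun q' hq' =>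
      Finset.mem_insert_of_mem (Finset.mem_biUnion.2 ⟨l, hl, TM2.stmts₁_trans hq hq'⟩)
    have hsupp := TM2.stmts₁_supportsStmt_mono hq (hS l hl)
    cases q with
    | goto l => exact hlabel _ (hsupp v)
    | halt => exact Finset.mem_insert_self _ _
    | branch f q₁ q₂ =>
      refine hsub _ ?_
      cases hf : f v <;> simp [finish, hf, TM2.stmts₁, TM2.stmts₁_self]
    | _ =>
      refine hsub _ ?_
      cases ph <;> simp [finish, TM2.stmts₁, TM2.stmts₁_self]
  refine ⟨fun p => p.1 ∈ T, ?_, fun v => hlabel l hl, ?_⟩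
  · refine ((T.finite_toSet.prod (Set.finite_univ (α := σ × Phase))).subset ?_).to_subtype
    exact fun p hp => ⟨hp, trivial⟩
  · rintro ⟨q, v, ph⟩ (_ | c) h
    · exact hfinish q h v ph
    · exact h

/-- A stack machine with finitely many accessible labels is simulated by a single consuming queue
machine. -/
theorem exists_singleConsuming [Finite σ] {S : Finset Λ}
    (hS : ∀ l ∈ S, TM2.SupportsStmt S (M l)) {l : Λ} (hl : l ∈ S) (v : σ) {ks : List K}
    (hks : ks.Nodup) (hmem : ∀ k, k ∈ ks) :
    ∃ (n m : ℕ) (N : QueueMachine (Fin n) (Fin m)) (e : K ⊕ A → Fin m), N.SingleConsuming ∧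
      ∀ s : K → List A, N.IsInput ((stackWord s ks).map e) ∧
        (N.Terminates ((stackWord s ks).map e) ↔ (eval (TM2.step M) ⟨some l, v, s⟩).Dom) := by
  obtain ⟨P, hfin, hstart, hδ⟩ := exists_finite_invariant (q₀ := M l) (v₀ := v) hS hl
  let N₁ := (machine M (M l) v).restrict P (hstart v) hδ
  obtain ⟨n, ⟨eQ⟩⟩ := Finite.exists_equiv_fin ({p // P p} ⊕ {p // P p})
  obtain ⟨m, ⟨eΓ⟩⟩ := Finite.exists_equiv_fin (Option (Option (K ⊕ A)))
  refine ⟨n, m, N₁.encode.reindex eQ eΓ, fun c => eΓ (some (some c)),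
    N₁.encode_singleConsuming.reindex eQ eΓ, fun s => ⟨?_, ?_⟩⟩
  · intro c hc
    obtain ⟨a, -, rfl⟩ := List.mem_map.1 hc
    cases a <;> simp [QueueMachine.reindex, QueueMachine.encode, N₁, QueueMachine.restrict, machine]
  · have h₁ := N₁.encode.reindex_terminates_iff eQ eΓ (((stackWord s ks).map some).map some)
    rw [N₁.encode_terminates_iff,
      (machine M (M l) v).restrict_terminates_iff P (hstart v) hδ,
      machine_terminates_iff hks hmem] at h₁
    simpa [Function.comp_def] using h₁

end StackToQueue

/-! ### Computability of the input word. -/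

/-- Binary digits are listed lowest first; this is the recursion behind `primrec_map_trNat`. -/
theorem trNat_eq_of_ne_zero {n : ℕ} (hn : n ≠ 0) :
    PartrecToTM2.trNat n =
      (if n % 2 = 0 then PartrecToTM2.Γ'.bit0 else PartrecToTM2.Γ'.bit1) ::
        PartrecToTM2.trNat (n / 2) := by
  have key : ∀ b : PosNum, PartrecToTM2.trNat ((b : PosNum) : ℕ) = PartrecToTM2.trPosNum b := by
    intro b
    rw [PartrecToTM2.trNat, PosNum.of_to_nat]
    rfl
  obtain ⟨p, rfl⟩ : ∃ p : PosNum, (p : ℕ) = n := by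
    rcases h : (n : Num) with _ | p
    · exact absurd (by simpa using congrArg (fun m : Num => (m : ℕ)) h) hn
    · exact ⟨p, by simpa using (congrArg (fun m : Num => (m : ℕ)) h).symm⟩
  cases p with
  | one =>
    rw [key]
    simp [PartrecToTM2.trPosNum]
  | bit0 p =>
    have h : ((PosNum.bit0 p : PosNum) : ℕ) = 2 * p := by simp [PosNum.cast_bit0]; omega
    rw [key, h]
    simp [key, PartrecToTM2.trPosNum]
  | bit1 p =>
    have h : ((PosNum.bit1 p : PosNum) : ℕ) = 2 * p + 1 := by simp [PosNum.cast_bit1]; omega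
    have h' : (2 * (p : ℕ) + 1) / 2 = p := by omega
    rw [key, h, h']
    simp [key, PartrecToTM2.trPosNum, Nat.add_mod]

theorem primrec_map_trNat (g : PartrecToTM2.Γ' → ℕ) :
    Primrec fun n => (PartrecToTM2.trNat n).map g := by
  -- In the strong recursion `l` lists all earlier values, so its length is the current argument and
  -- the entry at half that length is the value at the halved argument.
  have hg : Primrec₂ fun (_ : Unit) (l : List (List ℕ)) =>
      if l.length = 0 then some [] else
        (l[l.length / 2]?).map fun t =>
          (if l.length % 2 = 0 then g .bit0 else g .bit1) :: t := by
    have hlen : Primrec fun p : Unit × List (List ℕ) => p.2.length :=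
      Primrec.list_length.comp Primrec.snd
    refine Primrec.ite (Primrec.eq.comp hlen (Primrec.const 0)) (Primrec.const _) ?_
    refine Primrec.option_map
      (Primrec.list_getElem?.comp Primrec.snd (Primrec.nat_div.comp hlen (Primrec.const 2))) ?_
    refine Primrec.list_cons.comp (Primrec.ite (Primrec.eq.comp
      (Primrec.nat_mod.comp (hlen.comp Primrec.fst) (Primrec.const 2)) (Primrec.const 0))
      (Primrec.const _) (Primrec.const _)) Primrec.snd
  have := Primrec.nat_strong_rec (fun (_ : Unit) n => (PartrecToTM2.trNat n).map g) hg ?_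
  · exact this.comp (Primrec.const ()) Primrec.id
  · intro _ n
    rcases eq_or_ne n 0 with rfl | hn
    · simp
    · have h2 : n / 2 < n := by omega
      rw [trNat_eq_of_ne_zero hn]
      simp [hn, h2]
      split <;> rfl

namespace PartrecToQueue

instance : Fintype PartrecToTM2.K' where
  elems := {.main, .rev, .aux, .stack}
  complete := by rintro ⟨⟩ <;> simp

/-- The order of the stacks of Mathlib's stack machines in the queue. -/
def stackOrder : List PartrecToTM2.K' :=
  [.main, .rev, .aux, .stack]

/-- The queue word for the input `n` of a partial recursive function. -/
def inputWord (n : ℕ) : List (PartrecToTM2.K' ⊕ PartrecToTM2.Γ') :=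
  StackToQueue.stackWord (PartrecToTM2.K'.elim (PartrecToTM2.trList [n]) [] [] []) stackOrder

theorem primrec_map_inputWord (g : PartrecToTM2.K' ⊕ PartrecToTM2.Γ' → ℕ) :
    Primrec fun n => (inputWord n).map g := by
  have := Primrec.list_cons.comp (Primrec.const (g (.inl .main)))
    (Primrec.list_append.comp (primrec_map_trNat (g ∘ .inr))
      (Primrec.const [g (.inr .cons), g (.inl .rev), g (.inl .aux), g (.inl .stack)]))
  refine this.of_eq fun n => ?_
  simp [inputWord, stackOrder, StackToQueue.stackWord, PartrecToTM2.trList, PartrecToTM2.K'.elim]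

/-- The domain of a partial recursive function reduces to termination of a fixed single consuming
queue machine. -/
theorem exists_singleConsuming {f : ℕ →. ℕ} (hf : Partrec f) :
    ∃ (n m : ℕ) (N : QueueMachine (Fin n) (Fin m))
      (e : PartrecToTM2.K' ⊕ PartrecToTM2.Γ' → Fin m), N.SingleConsuming ∧
      ∀ k, N.IsInput ((inputWord k).map e) ∧
        (N.Terminates ((inputWord k).map e) ↔ (f k).Dom) := by
  obtain ⟨c, hc⟩ := ToPartrec.Code.exists_code (Nat.Partrec'.part_iff₁.2 hf)
  have hsupp := PartrecToTM2.tr_supports c .halt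
  obtain ⟨n, m, N, e, hN, h⟩ := StackToQueue.exists_singleConsuming (M := PartrecToTM2.tr) hsupp.2
    hsupp.1 none (ks := stackOrder) (by decide) (by rintro ⟨⟩ <;> decide)
  refine ⟨n, m, N, e, hN, fun k => ⟨(h _).1, (h _).2.trans ?_⟩⟩
  change (eval (TM2.step PartrecToTM2.tr) (PartrecToTM2.init c [k])).Dom ↔ _
  rw [PartrecToTM2.tr_eval, hc ⟨[k], rfl⟩]
  rfl

end PartrecToQueue

/-! ### Reduction from the halting problem. -/

/-- Termination of single consuming queue machines is undecidable. -/
theorem not_exists_decidesSingleConsumingTermination :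
    ¬ ∃ f : QueueMachineCode × List ℕ →. Bool,
      Partrec f ∧ DecidesSingleConsumingTermination f := by
  rintro ⟨f, hf, hdec⟩
  have huniv : Partrec fun k : ℕ => Nat.Partrec.Code.eval (Denumerable.ofNat _ k) 0 :=
    Nat.Partrec.Code.eval_part.comp (Computable.ofNat _) (Computable.const 0)
  obtain ⟨n, m, N, e, hN, h⟩ := PartrecToQueue.exists_singleConsuming huniv
  have hword : Computable fun c : Nat.Partrec.Code =>
      ((PartrecToQueue.inputWord (Encodable.encode c)).map e).map Fin.val := by
    simp only [List.map_map]
    exact (PartrecToQueue.primrec_map_inputWord _).to_comp.comp Computable.encode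
  have hans := fun c : Nat.Partrec.Code => hdec n m N hN _ (h (Encodable.encode c)).1
  choose b hb hb' using hans
  refine ComputablePred.halting_problem 0 (ComputablePred.computable_iff.2 ⟨b, ?_, ?_⟩)
  -- `f` may diverge elsewhere, but it answers on every pair formed here, so the composite is total
  -- and computable.
  · exact (hf.comp ((Computable.const N.code).pair hword)).of_eq_tot hb
  · funext c
    simpa using ((hb' c).trans (h _).2).symm

theorem mainTheorem8 :
    (¬ ∃ f : QueueMachineCode × List ℕ →. Bool,
      Partrec f ∧ DecidesSingleConsumingTermination f) ∧
    (∀ (Q Γ : Type*) [Finite Q] [Finite Γ] (M : QueueMachine Q Γ),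
      M.encode.SingleConsuming ∧
      ∀ x : List Γ, M.IsInput x → (M.Terminates x ↔ M.encode.Terminates (x.map some))) :=
  ⟨not_exists_decidesSingleConsumingTermination, fun _ _ _ _ M =>
    ⟨M.encode_singleConsuming, fun x _ => (M.encode_terminates_iff x).symm⟩⟩
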